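/- For a real matrix $M\in M(d,\mathbb R)$ let $\mathfrak g_M=\mathbb R e_0\ltimes_M\mathbb R^d$ be the almost abelian Lie algebra with underlying vector space $\mathbb R e_0\oplus\mathbb R^d$ in which $\mathbb R^d$ is an abelian ideal and $[e_0,v]=Mv$ for $v\in\mathbb R^d$. A complex structure on a real Lie algebra $\mathfrak g$ is a linear map $j:\mathfrak g\to\mathfrak g$ with $j^2=-\mathrm{id}$ and $[x,y]+j([jx,y]+[x,jy])-[jx,jy]=0$ for all $x,y\in\mathfrak g$. A symplectic structure on $\mathfrak g$ is a non-degenerate alternating bilinear form $\omega$ on $\mathfrak g$ with $\omega([x,y],z)+\omega([y,z],x)+\omega([z,x],y)=0$ for all $x,y,z\in\mathfrak g$. Let $n\ge 1$, let $M\in M(2n-1,\mathbb R)$, and let $M=M_s+M_n$ be its Jordan–Chevalley decomposition, that is, $M_s$ is semisimple (over $\mathbb R$), $M_n$ is nilpotent, and $M_sM_n=M_nM_s$. If $\mathfrak g_M$ admits a complex (resp. symplectic) structure, then both $\mathfrak g_{M_s}$ and $\mathfrak g_{M_n}$ admit a complex (resp. symplectic) structure. The converse fails in both cases: there exist $n\ge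 1$ and $M\in M(2n-1,\mathbb R)$ such that $\mathfrak g_{M_s}$ and $\mathfrak g_{M_n}$ both admit complex structures but $\mathfrak g_M$ does not; and there exist $n\ge 1$ and $M\in M(2n-1,\mathbb R)$ such that $\mathfrak g_{M_s}$ and $\mathfrak g_{M_n}$ both admit symplectic structures but $\mathfrak g_M$ does not. -/

import Mathlib

/-- A complex structure on a real Lie algebra `g`: a linear map `j` with `j² = -id` (hence a linear
automorphism) whose Nijenhuis tensor vanishes. -/
structure IsComplexStructure {g : Type*} [LieRing g] [LieAlgebra ℝ g] (j : g →ₗ[ℝ] g) : Prop where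
  sq_eq_neg : ∀ x, j (j x) = -x
  nijenhuis_eq_zero : ∀ x y : g, ⁅x, y⁆ + j (⁅j x, y⁆ + ⁅x, j y⁆) - ⁅j x, j y⁆ = 0

/-- A symplectic structure on a real Lie algebra `g`: a non-degenerate alternating bilinear form
which is closed for the Chevalley-Eilenberg differential. -/
structure IsSymplecticStructure {g : Type*} [LieRing g] [LieAlgebra ℝ g]
    (ω : LinearMap.BilinForm ℝ g) : Prop where
  isAlt : ω.IsAlt
  nondegenerate : ω.Nondegenerate
  closed : ∀ x y z : g, -ω ⁅x, y⁆ z - ω ⁅y, z⁆ x - ω ⁅z, x⁆ y = 0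

/-- The real Lie algebra `g` admits a complex structure. -/
def AdmitsComplexStructure (g : Type*) [LieRing g] [LieAlgebra ℝ g] : Prop :=
  ∃ j : g →ₗ[ℝ] g, IsComplexStructure j

/-- The real Lie algebra `g` admits a symplectic structure. -/
def AdmitsSymplecticStructure (g : Type*) [LieRing g] [LieAlgebra ℝ g] : Prop :=
  ∃ ω : LinearMap.BilinForm ℝ g, IsSymplecticStructure ω

/-- The underlying space `ℝ e₀ ⊕ ℝᵈ` of the almost abelian Lie algebra `g_M = ℝ e₀ ⋉_M ℝᵈ`; the
element `⟨t, v⟩` stands for `t e₀ + v`. -/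
@[ext]
structure AlmostAbelian {d : ℕ} (M : Matrix (Fin d) (Fin d) ℝ) : Type where
  coeff : ℝ
  vec : Fin d → ℝ

namespace AlmostAbelian

variable {d : ℕ} (M : Matrix (Fin d) (Fin d) ℝ)

/-- The identification of the underlying set with `ℝ × ℝᵈ`, along which the vector space structure
is transported. -/
def toProd : AlmostAbelian M ≃ ℝ × (Fin d → ℝ) where
  toFun x := (x.coeff, x.vec)
  invFun p := ⟨p.1, p.2⟩
  left_inv _ := rfl
  right_inv _ := rfl

noncomputable instance : AddCommGroup (AlmostAbelian M) := (toProd M).addCommGroup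

noncomputable instance : Module ℝ (AlmostAbelian M) := (toProd M).module ℝ

/-- The bracket determined by `[e₀, v] = M v` and `[v, w] = 0` for `v, w ∈ ℝᵈ`:
`[t e₀ + v, s e₀ + w] = t M w - s M v`. -/
noncomputable instance : Bracket (AlmostAbelian M) (AlmostAbelian M) where
  bracket x y := ⟨0, x.coeff • M.mulVec y.vec - y.coeff • M.mulVec x.vec⟩

theorem lie_def (x y : AlmostAbelian M) :
    ⁅x, y⁆ = ⟨0, x.coeff • M.mulVec y.vec - y.coeff • M.mulVec x.vec⟩ := rfl

theorem add_def (x y : AlmostAbelian M) : x + y = ⟨x.coeff + y.coeff, x.vec + y.vec⟩ := rfl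

theorem smul_def (t : ℝ) (x : AlmostAbelian M) : t • x = ⟨t * x.coeff, t • x.vec⟩ := rfl

theorem zero_def : (0 : AlmostAbelian M) = ⟨0, 0⟩ := rfl

noncomputable instance : LieRing (AlmostAbelian M) where
  add_lie x y z := by
    simp only [lie_def, add_def, Matrix.mulVec_add, AlmostAbelian.mk.injEq]
    exact ⟨by simp, by module⟩
  lie_add x y z := by
    simp only [lie_def, add_def, Matrix.mulVec_add, AlmostAbelian.mk.injEq]
    exact ⟨by simp, by module⟩
  lie_self x := by
    simp only [lie_def, zero_def, sub_self]
  leibniz_lie x y z := by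
    simp only [lie_def, add_def, Matrix.mulVec_sub, Matrix.mulVec_smul, AlmostAbelian.mk.injEq]
    exact ⟨by simp, by module⟩

noncomputable instance : LieAlgebra ℝ (AlmostAbelian M) where
  lie_smul t x y := by
    simp only [lie_def, smul_def, Matrix.mulVec_smul, AlmostAbelian.mk.injEq]
    exact ⟨by simp, by module⟩

end AlmostAbelian

/-- `M = S + N` is the (additive) Jordan-Chevalley decomposition of `M`: `S` is semisimple, `N` is
nilpotent, and they commute. -/
structure IsJordanChevalley {d : ℕ} (M S N : Matrix (Fin d) (Fin d) ℝ) : Prop where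
  eq_add : M = S + N
  commute : Commute S N
  isSemisimple : Module.End.IsSemisimple (Matrix.toLin' S)
  isNilpotent : IsNilpotent N

/-! Both structures on `g_M` reduce to a relation that `M` satisfies against data living on the
fixed space ℝ × ℝᵈ. A complex structure is a `j` with j² = -1 that commutes with `M` on ℝᵈ ∩ jℝᵈ
(`admitsComplexStructure_iff`); a symplectic one is a non-degenerate ω for whose restriction σ to ℝᵈ
the matrix `M` is skew (`admitsSymplecticStructure_iff`). The same `j` or ω then serves both
Jordan–Chevalley parts.

Commutation passes to every polynomial in `M`, hence to S = p(M) and N = M - S. Skewness does not;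
but σ(q(M)v, w) = σ(v, q(-M)w) for every q, so S is skew once p can be chosen with p(-M) = -S as
well (`IsJordanChevalley.exists_aeval_eq`).

The converses fail for J₂(0) ⊕ (1) in the complex case and for J₂(1) ⊕ (-1) ⊕ (-1) ⊕ (0) in the
symplectic case. -/

/-! ### Semisimple parts as polynomials -/

open Module.End in
theorem LinearMap.isSemisimple_prodMap {K V W : Type*} [Field K] [AddCommGroup V] [Module K V]
    [FiniteDimensional K V] [AddCommGroup W] [Module K W] [FiniteDimensional K W]
    {f : Module.End K V} {g : Module.End K W} (hf : f.IsSemisimple) (hg : g.IsSemisimple) :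
    Module.End.IsSemisimple (f.prodMap g) := by
  classical
  have hf0 := minpoly.ne_zero_of_finite K f
  have hg0 := minpoly.ne_zero_of_finite K g
  have key : ∀ q : Polynomial K, Polynomial.aeval (f.prodMap g) q =
      (Polynomial.aeval f q).prodMap (Polynomial.aeval g q) := by
    intro q
    have := Polynomial.aeval_algHom_apply (LinearMap.prodMapAlgHom K V W) (f, g) q
    rwa [Polynomial.aeval_prod_apply] at this
  -- The minimal polynomials need not be coprime, so their product may fail to be squarefree; its
  -- radical still annihilates both maps.
  set r := UniqueFactorizationMonoid.radical (minpoly K f * minpoly K g) with hr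
  have h1 : minpoly K f ∣ r :=
    ((hf.minpoly_squarefree.isRadical).dvd_radical hf0).trans
      (UniqueFactorizationMonoid.radical_dvd_radical (dvd_mul_right _ _) (mul_ne_zero hf0 hg0))
  have h2 : minpoly K g ∣ r :=
    ((hg.minpoly_squarefree.isRadical).dvd_radical hg0).trans
      (UniqueFactorizationMonoid.radical_dvd_radical (dvd_mul_left _ _) (mul_ne_zero hf0 hg0))
  refine isSemisimple_of_squarefree_aeval_eq_zero
    (UniqueFactorizationMonoid.squarefree_radical (a := minpoly K f * minpoly K g)) ?_
  rw [key, Polynomial.aeval_eq_zero_of_dvd_aeval_eq_zero h1 (minpoly.aeval K f),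
    Polynomial.aeval_eq_zero_of_dvd_aeval_eq_zero h2 (minpoly.aeval K g)]
  ext <;> simp

/-- The semisimple part of an endomorphism is a polynomial in it. -/
theorem Module.End.exists_aeval_eq_of_isSemisimple_of_isNilpotent {K V : Type*} [Field K]
    [PerfectField K] [AddCommGroup V] [Module K V] [FiniteDimensional K V] {s n : Module.End K V}
    (hs : s.IsSemisimple) (hn : IsNilpotent n) (h : Commute s n) :
    ∃ p : Polynomial K, Polynomial.aeval (s + n) p = s := by
  obtain ⟨n', -, s', hs'a, hn', hs', he⟩ :=
    Module.End.exists_isNilpotent_isSemisimple (K := K) (f := s + n)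
  have hc : Commute n' s' := by
    have h1 : n' = (s + n) - s' := by rw [he]; abel
    rw [h1]
    exact (Algebra.commute_of_mem_adjoin_self hs'a).sub_left (Commute.refl s')
  have hss := (Module.End.isNilpotent_isSemisimple_unique hn hs hn' hs' h.symm hc
    (by rw [← he, add_comm])).2
  rw [Algebra.adjoin_singleton_eq_range_aeval] at hs'a
  obtain ⟨q, hq⟩ := hs'a
  exact ⟨q, hq.trans hss.symm⟩

/-- The semisimple parts of `f` and `-f` are given by the same polynomial. -/
theorem Module.End.exists_aeval_eq_and_aeval_neg_eq {K V : Type*} [Field K]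
    [PerfectField K] [AddCommGroup V] [Module K V] [FiniteDimensional K V] {s n : Module.End K V}
    (hs : s.IsSemisimple) (hn : IsNilpotent n) (h : Commute s n) :
    ∃ p : Polynomial K, Polynomial.aeval (s + n) p = s ∧ Polynomial.aeval (-(s + n)) p = -s := by
  have hφ : Function.Injective (LinearMap.prodMapAlgHom K V V) := by
    rintro ⟨a, b⟩ ⟨a', b'⟩ hab
    ext x
    · simpa using congrArg Prod.fst (LinearMap.congr_fun hab (x, 0))
    · simpa using congrArg Prod.snd (LinearMap.congr_fun hab (0, x))
  have hc : Commute (s, -s) (n, -n) :=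
    Prod.ext h.eq (by simpa using h.eq)
  have hnn : IsNilpotent ((n, -n) : Module.End K V × Module.End K V) := by
    obtain ⟨k, hk⟩ := hn
    exact ⟨k, by rw [Prod.pow_mk, neg_pow, hk, mul_zero]; rfl⟩
  have hss : Module.End.IsSemisimple (LinearMap.prodMapAlgHom K V V (s, -s)) :=
    LinearMap.isSemisimple_prodMap hs (Module.End.isSemisimple_neg.2 hs)
  -- On V × V the pair (s + n, -(s + n)) has semisimple part (s, -s), so one polynomial handles both
  -- components.
  obtain ⟨p, hp⟩ := Module.End.exists_aeval_eq_of_isSemisimple_of_isNilpotent hss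
    (hnn.map (LinearMap.prodMapAlgHom K V V)) (hc.map (LinearMap.prodMapAlgHom K V V))
  rw [← map_add, Polynomial.aeval_algHom_apply] at hp
  have := hφ hp
  rw [Prod.mk_add_mk, Polynomial.aeval_prod_apply, Prod.mk.injEq] at this
  exact ⟨p, this.1, by rw [neg_add]; exact this.2⟩

theorem Matrix.toLin'_isSemisimple_of_pow_three_eq {d : ℕ} {S : Matrix (Fin d) (Fin d) ℝ}
    (h : S ^ 3 = S) : Module.End.IsSemisimple (Matrix.toLin' S) := by
  refine Module.End.isSemisimple_of_squarefree_aeval_eq_zero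
    (p := (Polynomial.X ^ 3 - Polynomial.X : Polynomial ℝ)) ?_ ?_
  · apply Polynomial.Separable.squarefree
    -- Bézout coefficients for X³ - X and its derivative 3X² - 1.
    refine ⟨-Polynomial.C (9 / 2) * Polynomial.X,
      Polynomial.C (3 / 2) * Polynomial.X ^ 2 - 1, ?_⟩
    have e : (Polynomial.C (9 / 2) : Polynomial ℝ) = 3 * Polynomial.C (3 / 2) := by
      rw [show (3 : Polynomial ℝ) = Polynomial.C 3 from rfl, ← Polynomial.C_mul]; norm_num
    have e2 : (2 : Polynomial ℝ) * Polynomial.C (3 / 2) = 3 := by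
      rw [show (3 : Polynomial ℝ) = Polynomial.C 3 from rfl,
        show (2 : Polynomial ℝ) = Polynomial.C 2 from rfl, ← Polynomial.C_mul]; norm_num
    simp only [Polynomial.derivative_sub, Polynomial.derivative_X_pow, Polynomial.derivative_X,
      e, Nat.cast_ofNat]
    rw [show (Polynomial.C 3 : Polynomial ℝ) = 3 from rfl]
    linear_combination (Polynomial.X ^ 2) * e2
  · simp only [map_sub, map_pow, Polynomial.aeval_X]
    rw [← Matrix.toLin'_pow, h, sub_self]

/-! ### Structures on `g_M` as conditions on `M` -/

theorem LinearMap.nijenhuis_eq_zero_iff {V : Type*} [AddCommGroup V] [Module ℝ V]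
    {φ : V →ₗ[ℝ] ℝ} {D j : V →ₗ[ℝ] V} {e₀ : V} (he₀ : φ e₀ = 1) (hj : ∀ x, j (j x) = -x) :
    (∀ x y, (φ x • D y - φ y • D x) +
        j ((φ (j x) • D y - φ y • D (j x)) + (φ x • D (j y) - φ (j y) • D x)) -
        (φ (j x) • D (j y) - φ (j y) • D (j x)) = 0) ↔
      ∀ x, φ x = 0 → φ (j x) = 0 → j (D x) = D (j x) := by
  set c := φ (j e₀) with hc
  have hc0 : 1 + c ^ 2 ≠ 0 := by positivity
  constructor
  · intro h x hx hjx
    have h1 := h e₀ x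
    rw [he₀, hx, hjx, ← hc] at h1
    simp only [zero_smul, sub_zero, one_smul, map_add, map_smul] at h1
    have h2 := congrArg j h1
    simp only [map_add, map_sub, map_smul, map_zero, hj] at h2
    have h3 : (1 + c ^ 2) • (j (D x) - D (j x)) = 0 := by
      -- Adding `c` times the identity to its image under `j` cancels the terms without the factor 1
      -- + c².
      linear_combination (norm := module) c • h1 + h2
    exact sub_eq_zero.1 ((smul_eq_zero.1 h3).resolve_left hc0)
  · intro h x y
    -- With this `e`, the space splits as span(e, je) ⊕ (ker φ ∩ ker φ∘j), and the hypothesis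
    -- governs the second summand.
    obtain ⟨e, he, hje⟩ : ∃ e, φ e = 1 ∧ φ (j e) = 0 := by
      refine ⟨(1 + c ^ 2)⁻¹ • (e₀ + c • j e₀), ?_, ?_⟩
      · simp only [map_smul, map_add, he₀, ← hc, smul_eq_mul]
        field_simp
      · simp [hj, he₀, ← hc]
    have key : ∀ x, j (D x) - φ x • j (D e) + φ (j x) • j (D (j e)) =
        D (j x) - φ x • D (j e) - φ (j x) • D e := by
      intro x
      have := h (x - φ x • e + φ (j x) • j e) (by simp [he, hje]) (by simp [he, hje, hj])
      simpa [hj, sub_eq_add_neg] using this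
    have hx := key x
    have hy := key y
    have hjx := congrArg j hx
    have hjy := congrArg j hy
    simp only [map_add, map_sub, map_smul, hj] at hjx hjy ⊢
    linear_combination (norm := module) φ (j x) • hy - φ x • hjy - φ (j y) • hx + φ y • hjx

namespace AlmostAbelian

variable {d : ℕ} (M : Matrix (Fin d) (Fin d) ℝ)

/-- The underlying vector space of `g_M` does not depend on `M`. -/
noncomputable def linearEquivProd : AlmostAbelian M ≃ₗ[ℝ] ℝ × (Fin d → ℝ) where
  __ := toProd M
  map_add' _ _ := rfl
  map_smul' _ _ := rfl

@[simp] theorem linearEquivProd_apply (x : AlmostAbelian M) :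
    linearEquivProd M x = (x.coeff, x.vec) := rfl

@[simp] theorem linearEquivProd_symm_apply (x : ℝ × (Fin d → ℝ)) :
    (linearEquivProd M).symm x = ⟨x.1, x.2⟩ := rfl

end AlmostAbelian

open AlmostAbelian

variable {d : ℕ}

/-- `j` induces a complex structure, commuting with `M`, on the subspace `ℝᵈ ∩ j ℝᵈ`. -/
def IsComplexAdapted (j : (ℝ × (Fin d → ℝ)) →ₗ[ℝ] ℝ × (Fin d → ℝ))
    (M : Matrix (Fin d) (Fin d) ℝ) : Prop :=
  ∀ v, (j (0, v)).1 = 0 → j (0, M.mulVec v) = (0, M.mulVec (j (0, v)).2)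

theorem admitsComplexStructure_iff (M : Matrix (Fin d) (Fin d) ℝ) :
    AdmitsComplexStructure (AlmostAbelian M) ↔
      ∃ j : (ℝ × (Fin d → ℝ)) →ₗ[ℝ] ℝ × (Fin d → ℝ),
        (∀ x, j (j x) = -x) ∧ IsComplexAdapted j M := by
  let D : (ℝ × (Fin d → ℝ)) →ₗ[ℝ] ℝ × (Fin d → ℝ) :=
    LinearMap.inr ℝ ℝ (Fin d → ℝ) ∘ₗ M.mulVecLin ∘ₗ LinearMap.snd ℝ ℝ (Fin d → ℝ)
  have hD : ∀ x, D x = (0, M.mulVec x.2) := fun _ ↦ rfl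
  have hiff : ∀ j : (ℝ × (Fin d → ℝ)) →ₗ[ℝ] ℝ × (Fin d → ℝ), IsComplexAdapted j M ↔
      ∀ x, LinearMap.fst ℝ ℝ (Fin d → ℝ) x = 0 → LinearMap.fst ℝ ℝ (Fin d → ℝ) (j x) = 0 →
        j (D x) = D (j x) := by
    intro j
    constructor
    · rintro h ⟨t, v⟩ ht hv
      obtain rfl : t = 0 := ht
      exact h v hv
    · intro h v hv
      exact h (0, v) rfl hv
  have hlie : ∀ x y : AlmostAbelian M, linearEquivProd M ⁅x, y⁆ =
      x.coeff • D (linearEquivProd M y) - y.coeff • D (linearEquivProd M x) := by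
    intro x y
    simp [hD, lie_def]
  have hnij := fun (j : (ℝ × (Fin d → ℝ)) →ₗ[ℝ] ℝ × (Fin d → ℝ)) ↦
    LinearMap.nijenhuis_eq_zero_iff (φ := LinearMap.fst ℝ ℝ (Fin d → ℝ)) (D := D) (j := j)
      (e₀ := (1, 0)) rfl
  constructor
  · rintro ⟨j, hj⟩
    have hj' : ∀ x, (linearEquivProd M).conj j ((linearEquivProd M).conj j x) = -x := by
      intro x
      rw [LinearEquiv.conj_apply_apply, LinearEquiv.conj_apply_apply,
        LinearEquiv.symm_apply_apply, hj.sq_eq_neg, map_neg, LinearEquiv.apply_symm_apply]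
    refine ⟨(linearEquivProd M).conj j, hj', (hiff _).2 ((hnij _ hj').1 ?_)⟩
    intro x y
    have := congrArg (linearEquivProd M) (hj.nijenhuis_eq_zero ((linearEquivProd M).symm x)
      ((linearEquivProd M).symm y))
    rw [map_sub, map_add, map_zero, hlie, hlie] at this
    rw [← this]
    simp only [LinearEquiv.conj_apply_apply]
    congr 3
    apply congrArg j
    apply (linearEquivProd M).injective
    simp only [map_add, hlie, LinearEquiv.apply_symm_apply]
    rfl
  · rintro ⟨j, hj, h⟩
    refine ⟨(linearEquivProd M).symm.conj j, ?_, ?_⟩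
    · intro x
      rw [LinearEquiv.conj_apply_apply, LinearEquiv.conj_apply_apply, LinearEquiv.symm_symm,
        LinearEquiv.apply_symm_apply, hj, map_neg, LinearEquiv.symm_apply_apply]
    · intro x y
      have := (hnij j hj).2 ((hiff j).1 h) (linearEquivProd M x) (linearEquivProd M y)
      apply (linearEquivProd M).injective
      rw [map_sub, map_add, map_zero, hlie, hlie, ← this, LinearEquiv.conj_apply_apply,
        LinearEquiv.conj_apply_apply, LinearEquiv.conj_apply_apply, LinearEquiv.symm_symm,
        map_add, hlie, hlie]
      simp only [LinearEquiv.apply_symm_apply]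
      rfl

/-- Closedness is empty on triples from the abelian ideal, so only triples (e₀, v, w) impose a
condition. -/
theorem admitsSymplecticStructure_iff (M : Matrix (Fin d) (Fin d) ℝ) :
    AdmitsSymplecticStructure (AlmostAbelian M) ↔
      ∃ ω : LinearMap.BilinForm ℝ (ℝ × (Fin d → ℝ)), ω.IsAlt ∧ ω.Nondegenerate ∧
        ∀ v w, ω (0, M.mulVec v) (0, w) = ω (0, M.mulVec w) (0, v) := by
  constructor
  · rintro ⟨ω, hω⟩
    refine ⟨LinearMap.BilinForm.congr (linearEquivProd M) ω, ?_, ?_, ?_⟩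
    · intro x
      simpa using hω.isAlt _
    · exact (LinearMap.BilinForm.nondegenerate_congr_iff _).2 hω.nondegenerate
    · intro v w
      have := hω.closed ⟨1, 0⟩ ⟨0, v⟩ ⟨0, w⟩
      simp [lie_def, ← zero_def] at this
      have e : (⟨0, -M.mulVec w⟩ : AlmostAbelian M) = -⟨0, M.mulVec w⟩ := by
        refine eq_neg_of_add_eq_zero_left ?_
        simp [add_def, zero_def]
      rw [e] at this
      simp at this
      simp
      linarith
  · rintro ⟨ω, ha, hn, h⟩
    refine ⟨LinearMap.BilinForm.congr (linearEquivProd M).symm ω, ?_, ?_, ?_⟩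
    · intro x
      simpa using ha _
    · exact (LinearMap.BilinForm.nondegenerate_congr_iff _).2 hn
    · rintro ⟨t, u⟩ ⟨s, v⟩ ⟨r, w⟩
      have e : ∀ (a : ℝ) (z : Fin d → ℝ), (a, z) = a • ((1, 0) : ℝ × (Fin d → ℝ)) + (0, z) := by
        intro a z; simp
      have e2 : ∀ (a b : ℝ) (y z : Fin d → ℝ), ((0, a • y - b • z) : ℝ × (Fin d → ℝ)) =
          a • (0, y) - b • (0, z) := by
        intro a b y z; simp
      simp only [lie_def, LinearMap.BilinForm.congr_apply, LinearEquiv.symm_symm,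
        linearEquivProd_apply]
      rw [e t, e s, e r, e2, e2, e2]
      simp only [map_add, map_sub, map_smul, LinearMap.sub_apply, LinearMap.smul_apply,
        smul_eq_mul]
      linear_combination (-t) * h v w - s * h w u - r * h u v

/-! ### Passage to the semisimple and nilpotent parts -/

theorem IsComplexAdapted.of_mem_adjoin {j : (ℝ × (Fin d → ℝ)) →ₗ[ℝ] ℝ × (Fin d → ℝ)}
    {M A : Matrix (Fin d) (Fin d) ℝ} (h : IsComplexAdapted j M)
    (hA : A ∈ Algebra.adjoin ℝ {M}) : IsComplexAdapted j A := by
  have hj : ∀ v, (j (0, v)).1 = 0 → j (0, v) = (0, (j (0, v)).2) := fun v hv ↦ Prod.ext hv rfl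
  induction hA using Algebra.adjoin_induction with
  | mem x hx => rwa [Set.mem_singleton_iff.1 hx]
  | algebraMap r =>
    intro v hv
    have e : ((0, r • v) : ℝ × (Fin d → ℝ)) = r • (0, v) := by simp
    rw [Algebra.algebraMap_eq_smul_one, Matrix.smul_mulVec, Matrix.one_mulVec,
      Matrix.smul_mulVec, Matrix.one_mulVec, e, map_smul, hj v hv]
    simp
  | add A B _ _ ihA ihB =>
    intro v hv
    have e : ((0, (A + B).mulVec v) : ℝ × (Fin d → ℝ)) = (0, A.mulVec v) + (0, B.mulVec v) := by
      simp [Matrix.add_mulVec]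
    rw [e, map_add, ihA v hv, ihB v hv, Matrix.add_mulVec]
    simp
  | mul A B _ _ ihA ihB =>
    intro v hv
    have h1 := ihB v hv
    -- Being adapted includes invariance: Bv lies again in ℝᵈ ∩ jℝᵈ, so the hypothesis on `A`
    -- applies to it.
    rw [← Matrix.mulVec_mulVec, ihA _ (by rw [h1]), h1, Matrix.mulVec_mulVec]

theorem LinearMap.BilinForm.apply_aeval_mulVec_eq {σ : LinearMap.BilinForm ℝ (Fin d → ℝ)}
    {A A' : Matrix (Fin d) (Fin d) ℝ}
    (h : ∀ v w, σ (A.mulVec v) w = σ v (A'.mulVec w)) (p : Polynomial ℝ) :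
    ∀ v w, σ ((Polynomial.aeval A p).mulVec v) w = σ v ((Polynomial.aeval A' p).mulVec w) := by
  induction p using Polynomial.induction_on with
  | C a => simp [Algebra.algebraMap_eq_smul_one, Matrix.smul_mulVec]
  | add p q hp hq =>
    intro v w
    simp only [map_add, Matrix.add_mulVec, LinearMap.add_apply, hp v w, hq v w]
  | monomial n a ih =>
    intro v w
    rw [pow_succ, ← mul_assoc, map_mul, Polynomial.aeval_X, ← Matrix.mulVec_mulVec, ih, h,
      mul_comm _ Polynomial.X, map_mul (Polynomial.aeval A') Polynomial.X, Polynomial.aeval_X,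
      Matrix.mulVec_mulVec]

theorem IsJordanChevalley.exists_aeval_eq {M S N : Matrix (Fin d) (Fin d) ℝ}
    (h : IsJordanChevalley M S N) :
    ∃ p : Polynomial ℝ, Polynomial.aeval M p = S ∧ Polynomial.aeval (-M) p = -S := by
  have hn : IsNilpotent (Matrix.toLinAlgEquiv' N) := h.isNilpotent.map Matrix.toLinAlgEquiv'
  have hc : Commute (Matrix.toLinAlgEquiv' S) (Matrix.toLinAlgEquiv' N) :=
    h.commute.map Matrix.toLinAlgEquiv'
  obtain ⟨p, h1, h2⟩ := Module.End.exists_aeval_eq_and_aeval_neg_eq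
    (s := Matrix.toLinAlgEquiv' S) h.isSemisimple hn hc
  refine ⟨p, Matrix.toLinAlgEquiv'.injective ?_, Matrix.toLinAlgEquiv'.injective ?_⟩
  · rw [← Polynomial.aeval_algHom_apply, h.eq_add, map_add, h1]
  · rw [← Polynomial.aeval_algHom_apply, h.eq_add, map_neg, map_add, h2, map_neg]

theorem IsJordanChevalley.admitsComplexStructure {M S N : Matrix (Fin d) (Fin d) ℝ}
    (h : IsJordanChevalley M S N) (hM : AdmitsComplexStructure (AlmostAbelian M)) :
    AdmitsComplexStructure (AlmostAbelian S) ∧ AdmitsComplexStructure (AlmostAbelian N) := by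
  obtain ⟨j, hj, ha⟩ := (admitsComplexStructure_iff M).1 hM
  obtain ⟨p, hp, -⟩ := h.exists_aeval_eq
  have hS : S ∈ Algebra.adjoin ℝ {M} := hp ▸ Polynomial.aeval_mem_adjoin_singleton ℝ M
  have hN : N ∈ Algebra.adjoin ℝ {M} := by
    rw [← add_sub_cancel_left S N, ← h.eq_add]
    exact sub_mem (Algebra.self_mem_adjoin_singleton ℝ M) hS
  exact ⟨(admitsComplexStructure_iff S).2 ⟨j, hj, ha.of_mem_adjoin hS⟩,
    (admitsComplexStructure_iff N).2 ⟨j, hj, ha.of_mem_adjoin hN⟩⟩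

theorem IsJordanChevalley.admitsSymplecticStructure {M S N : Matrix (Fin d) (Fin d) ℝ}
    (h : IsJordanChevalley M S N) (hM : AdmitsSymplecticStructure (AlmostAbelian M)) :
    AdmitsSymplecticStructure (AlmostAbelian S) ∧ AdmitsSymplecticStructure (AlmostAbelian N) := by
  obtain ⟨ω, halt, hnd, hω⟩ := (admitsSymplecticStructure_iff M).1 hM
  obtain ⟨p, hp, hp'⟩ := h.exists_aeval_eq
  let ι := LinearMap.inr ℝ ℝ (Fin d → ℝ)
  let σ : LinearMap.BilinForm ℝ (Fin d → ℝ) := ω.compl₁₂ ι ι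
  have hσ : ∀ v w, σ v w = ω (0, v) (0, w) := fun _ _ ↦ rfl
  have hσn : ∀ v w, σ v w = -σ w v := fun v w ↦ (halt.neg_eq _ _).symm
  have hMs : ∀ v w, σ (M.mulVec v) w = σ (M.mulVec w) v := hω
  have hSs : ∀ v w, σ (S.mulVec v) w = σ (S.mulVec w) v := by
    intro v w
    have := LinearMap.BilinForm.apply_aeval_mulVec_eq (σ := σ) (A := M) (A' := -M)
      (fun v w ↦ by rw [hMs, hσn, Matrix.neg_mulVec, map_neg]) p v w
    rw [hp, hp', Matrix.neg_mulVec, map_neg] at this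
    rw [this, hσn (S.mulVec w)]
  refine ⟨(admitsSymplecticStructure_iff S).2 ⟨ω, halt, hnd, hSs⟩,
    (admitsSymplecticStructure_iff N).2 ⟨ω, halt, hnd, fun v w ↦ ?_⟩⟩
  -- The condition is linear in the matrix, so the nilpotent part follows by subtraction.
  have := hMs v w
  rw [h.eq_add, Matrix.add_mulVec, Matrix.add_mulVec, map_add, map_add, LinearMap.add_apply,
    LinearMap.add_apply, hSs v w] at this
  exact add_left_cancel this

/-! ### Counterexamples to the converses -/

/-- Otherwise `j` would preserve the one-dimensional eigenspace and act on it by a real c with c² =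
-1. -/
theorem IsComplexAdapted.fst_apply_ne_zero {d : ℕ}
    {j : (ℝ × (Fin d → ℝ)) →ₗ[ℝ] ℝ × (Fin d → ℝ)} {M : Matrix (Fin d) (Fin d) ℝ}
    (h : IsComplexAdapted j M) (hj : ∀ x, j (j x) = -x) {v : Fin d → ℝ} (hv : v ≠ 0) {μ : ℝ}
    (hμ : M.mulVec v = μ • v) (hdim : ∀ w, M.mulVec w = μ • w → ∃ c : ℝ, w = c • v) :
    (j (0, v)).1 ≠ 0 := by
  intro h0
  have smul_mk : ∀ (c : ℝ) (v : Fin d → ℝ), ((0, c • v) : ℝ × (Fin d → ℝ)) = c • (0, v) := by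
    simp
  have h1 := h v h0
  rw [hμ, smul_mk, map_smul] at h1
  obtain ⟨c, hc⟩ := hdim _ (congrArg Prod.snd h1).symm
  have h2 : j (0, v) = c • (0, v) := by
    rw [← smul_mk, ← hc]
    exact Prod.ext h0 rfl
  have h3 := hj (0, v)
  rw [h2, map_smul, h2, smul_smul] at h3
  have h4 : (c * c + 1) • v = 0 := by
    rw [add_smul, one_smul]
    exact eq_neg_iff_add_eq_zero.1 (congrArg Prod.snd h3)
  rcases smul_eq_zero.1 h4 with h5 | h5
  · nlinarith [mul_self_nonneg c]
  · exact hv h5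

theorem exists_complex_jordanChevalley_parts_not :
    ∃ M Ms Mn : Matrix (Fin 3) (Fin 3) ℝ, IsJordanChevalley M Ms Mn ∧
      AdmitsComplexStructure (AlmostAbelian Ms) ∧ AdmitsComplexStructure (AlmostAbelian Mn) ∧
      ¬ AdmitsComplexStructure (AlmostAbelian M) := by
  refine ⟨!![0, 1, 0; 0, 0, 0; 0, 0, 1], !![0, 0, 0; 0, 0, 0; 0, 0, 1],
    !![0, 1, 0; 0, 0, 0; 0, 0, 0], ⟨?_, ?_, ?_, ?_⟩, ?_, ?_, ?_⟩
  · simp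
  · simp [Commute, SemiconjBy]
    ext i
    fin_cases i <;> rfl
  · exact Matrix.toLin'_isSemisimple_of_pow_three_eq (by
      simp [pow_succ]
      ext i
      fin_cases i <;> rfl)
  · refine ⟨2, ?_⟩
    ext i j
    fin_cases i <;> fin_cases j <;> simp [pow_succ]
  -- Both parts have rank one. In each case `j` is chosen so that ℝ³ ∩ jℝ³ is the kernel of the
  -- matrix, where commutation is trivial.
  · refine (admitsComplexStructure_iff _).2 ⟨
      { toFun x := (-x.2 2, ![-x.2 1, x.2 0, x.1])
        map_add' x y := by ext i; · simp; ring
                           · fin_cases i <;> simp; ring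
        map_smul' a x := by ext i; · simp
                            · fin_cases i <;> simp }, ?_, ?_⟩
    · intro x
      ext i
      · simp
      · fin_cases i <;> simp
    · intro v hv
      simp at hv
      ext i
      · simp [dotProduct, Fin.sum_univ_three, hv]
      · fin_cases i <;> simp [dotProduct, Fin.sum_univ_three, hv]
  · refine (admitsComplexStructure_iff _).2 ⟨
      { toFun x := (-x.2 1, ![-x.2 2, x.1, x.2 0])
        map_add' x y := by ext i; · simp; ring
                           · fin_cases i <;> simp; ring
        map_smul' a x := by ext i; · simp
                            · fin_cases i <;> simp }, ?_, ?_⟩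
    · intro x
      ext i
      · simp
      · fin_cases i <;> simp
    · intro v hv
      simp at hv
      ext i
      · simp [dotProduct, Fin.sum_univ_three, hv]
      · fin_cases i <;> simp [dotProduct, Fin.sum_univ_three, hv]
  · rw [admitsComplexStructure_iff]
    rintro ⟨j, hj, h⟩
    have h1 : (j (0, ![1, 0, 0])).1 ≠ 0 := by
      refine h.fst_apply_ne_zero hj (μ := 0) (by simp) 
        (by ext i; fin_cases i <;> simp) ?_
      intro w hw
      simp [dotProduct, Fin.sum_univ_three, funext_iff, Fin.forall_fin_succ] at hw
      refine ⟨w 0, ?_⟩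
      ext i
      fin_cases i <;> simp [hw]
    have h3 : (j (0, ![0, 0, 1])).1 ≠ 0 := by
      refine h.fst_apply_ne_zero hj (μ := 1) (by simp)
        (by ext i; fin_cases i <;> simp) ?_
      intro w hw
      simp [dotProduct, Fin.sum_univ_three, funext_iff, Fin.forall_fin_succ] at hw
      refine ⟨w 2, ?_⟩
      obtain ⟨h0, h1⟩ := hw
      rw [← h1] at h0
      ext i
      fin_cases i <;> simp [← h0, ← h1]
    set a := (j (0, ![1, 0, 0])).1 with ha
    set b := (j (0, ![0, 0, 1])).1 with hb
    have e : ∀ x z : ℝ, ((0, ![x, 0, z]) : ℝ × (Fin 3 → ℝ)) =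
        x • (0, ![1, 0, 0]) + z • (0, ![0, 0, 1]) := by
      intro x z
      ext i
      · simp
      · fin_cases i <;> simp
    have hv : ∀ x z : ℝ, (j (0, ![x, 0, z])).1 = x * a + z * b := by
      intro x z
      rw [e, map_add, map_smul, map_smul, Prod.fst_add, Prod.smul_fst, Prod.smul_fst, smul_eq_mul,
        smul_eq_mul]
    -- This combination of the two eigenvectors lies in ℝ³ ∩ jℝ³, so its image under `M`, a non-zero
    -- multiple of the second one, would too.
    have h4 := congrArg Prod.fst (h ![b, 0, -a] (by rw [hv]; ring))
    have h5 : Matrix.mulVec !![0, 1, 0; 0, 0, 0; 0, 0, 1] ![b, 0, -a] = ![0, 0, -a] := by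
      ext i
      fin_cases i <;> simp
    rw [h5, hv] at h4
    simp [h1, h3] at h4

theorem exists_symplectic_jordanChevalley_parts_not :
    ∃ M Ms Mn : Matrix (Fin 5) (Fin 5) ℝ, IsJordanChevalley M Ms Mn ∧
      AdmitsSymplecticStructure (AlmostAbelian Ms) ∧
      AdmitsSymplecticStructure (AlmostAbelian Mn) ∧
      ¬ AdmitsSymplecticStructure (AlmostAbelian M) := by
  refine ⟨!![1, 1, 0, 0, 0; 0, 1, 0, 0, 0; 0, 0, -1, 0, 0; 0, 0, 0, -1, 0; 0, 0, 0, 0, 0],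
    !![1, 0, 0, 0, 0; 0, 1, 0, 0, 0; 0, 0, -1, 0, 0; 0, 0, 0, -1, 0; 0, 0, 0, 0, 0],
    !![0, 1, 0, 0, 0; 0, 0, 0, 0, 0; 0, 0, 0, 0, 0; 0, 0, 0, 0, 0; 0, 0, 0, 0, 0],
    ⟨?_, ?_, ?_, ?_⟩, ?_, ?_, ?_⟩
  · simp
  · simp [Commute, SemiconjBy]
  · exact Matrix.toLin'_isSemisimple_of_pow_three_eq (by
      simp [pow_succ]
      ext i
      fin_cases i <;> rfl)
  · refine ⟨2, ?_⟩
    ext i j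
    fin_cases i <;> fin_cases j <;> simp [pow_succ]
  -- The form pairs the eigenvalue 1 with -1, and e₀ with the kernel vector.
  · obtain ⟨ω, hω⟩ : ∃ ω : LinearMap.BilinForm ℝ (ℝ × (Fin 5 → ℝ)), ∀ x y, ω x y =
        x.1 * y.2 4 - x.2 4 * y.1 + (x.2 0 * y.2 2 - x.2 2 * y.2 0) +
        (x.2 1 * y.2 3 - x.2 3 * y.2 1) :=
      ⟨LinearMap.mk₂ ℝ (fun x y ↦ x.1 * y.2 4 - x.2 4 * y.1 + (x.2 0 * y.2 2 - x.2 2 * y.2 0) +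
        (x.2 1 * y.2 3 - x.2 3 * y.2 1))
        (by intros; simp; ring) (by intros; simp; ring)
        (by intros; simp; ring) (by intros; simp; ring), fun _ _ ↦ rfl⟩
    have halt : ω.IsAlt := by
      intro x
      rw [hω]
      ring
    refine (admitsSymplecticStructure_iff _).2
      ⟨ω, halt, halt.isRefl.nondegenerate_iff_separatingLeft.2 ?_, ?_⟩
    · intro x hx
      have h0 := hx (1, 0)
      have h1 := hx (0, Pi.single 0 1)
      have h2 := hx (0, Pi.single 1 1)
      have h3 := hx (0, Pi.single 2 1)
      have h4 := hx (0, Pi.single 3 1)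
      have h5 := hx (0, Pi.single 4 1)
      simp [hω] at h0 h1 h2 h3 h4 h5
      ext i
      · simpa using h5
      · fin_cases i <;> simp [*]
    · intro v w
      simp [hω, dotProduct, Fin.sum_univ_five]
      ring
  -- Here the nilpotent block gets its own plane, on which it is skew because sp(2) consists of the
  -- traceless matrices.
  · obtain ⟨ω, hω⟩ : ∃ ω : LinearMap.BilinForm ℝ (ℝ × (Fin 5 → ℝ)), ∀ x y, ω x y =
        x.1 * y.2 4 - x.2 4 * y.1 + (x.2 0 * y.2 1 - x.2 1 * y.2 0) +
        (x.2 2 * y.2 3 - x.2 3 * y.2 2) :=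
      ⟨LinearMap.mk₂ ℝ (fun x y ↦ x.1 * y.2 4 - x.2 4 * y.1 + (x.2 0 * y.2 1 - x.2 1 * y.2 0) +
        (x.2 2 * y.2 3 - x.2 3 * y.2 2))
        (by intros; simp; ring) (by intros; simp; ring)
        (by intros; simp; ring) (by intros; simp; ring), fun _ _ ↦ rfl⟩
    have halt : ω.IsAlt := by
      intro x
      rw [hω]
      ring
    refine (admitsSymplecticStructure_iff _).2
      ⟨ω, halt, halt.isRefl.nondegenerate_iff_separatingLeft.2 ?_, ?_⟩
    · intro x hx
      have h0 := hx (1, 0)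
      have h1 := hx (0, Pi.single 0 1)
      have h2 := hx (0, Pi.single 1 1)
      have h3 := hx (0, Pi.single 2 1)
      have h4 := hx (0, Pi.single 3 1)
      have h5 := hx (0, Pi.single 4 1)
      simp [hω] at h0 h1 h2 h3 h4 h5
      ext i
      · simpa using h5
      · fin_cases i <;> simp [*]
    · intro v w
      simp [hω, dotProduct, Fin.sum_univ_five]
      ring
  · rw [admitsSymplecticStructure_iff]
    rintro ⟨ω, halt, hnd, h⟩
    set M : Matrix (Fin 5) (Fin 5) ℝ :=
      !![1, 1, 0, 0, 0; 0, 1, 0, 0, 0; 0, 0, -1, 0, 0; 0, 0, 0, -1, 0; 0, 0, 0, 0, 0] with hM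
    let e : Fin 5 → ℝ × (Fin 5 → ℝ) := fun i ↦ (0, Pi.single i 1)
    have hsp : ∀ x : ℝ × (Fin 5 → ℝ), x = x.1 • ((1, 0) : ℝ × (Fin 5 → ℝ)) + x.2 0 • e 0 +
        x.2 1 • e 1 + x.2 2 • e 2 + x.2 3 • e 3 + x.2 4 • e 4 := by
      intro x
      ext i
      · simp [e]
      · fin_cases i <;> simp [e]
    have hMe : ∀ i j, ω (0, M.mulVec (Pi.single i 1)) (e j) =
        ω (0, M.mulVec (Pi.single j 1)) (e i) := fun i j ↦ h _ _
    have m0 : ((0, M.mulVec (Pi.single 0 1)) : ℝ × (Fin 5 → ℝ)) = e 0 := by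
      ext i
      · simp [e]
      · fin_cases i <;> simp [e, hM]
    have m1 : ((0, M.mulVec (Pi.single 1 1)) : ℝ × (Fin 5 → ℝ)) = e 0 + e 1 := by
      ext i
      · simp [e]
      · fin_cases i <;> simp [e, hM]
    have m2 : ((0, M.mulVec (Pi.single 2 1)) : ℝ × (Fin 5 → ℝ)) = -e 2 := by
      ext i
      · simp [e]
      · fin_cases i <;> simp [e, hM]
    have m3 : ((0, M.mulVec (Pi.single 3 1)) : ℝ × (Fin 5 → ℝ)) = -e 3 := by
      ext i
      · simp [e]
      · fin_cases i <;> simp [e, hM]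
    have m4 : ((0, M.mulVec (Pi.single 4 1)) : ℝ × (Fin 5 → ℝ)) = 0 := by
      ext i
      · simp
      · fin_cases i <;> simp [hM]
    have hneg : ∀ x y, ω x y = -ω y x := fun x y ↦ (halt.neg_eq y x).symm
    have e00 : ω (e 0) (e 0) = 0 := halt _
    have e44 : ω (e 4) (e 4) = 0 := halt _
    have h01 := hMe 0 1
    have h12 := hMe 1 2
    have h13 := hMe 1 3
    have h40 := hMe 4 0
    have h41 := hMe 4 1
    have h42 := hMe 4 2
    have h43 := hMe 4 3
    simp only [m0, m1, m2, m3, m4, map_add, map_neg, map_zero, LinearMap.add_apply,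
      LinearMap.neg_apply, LinearMap.zero_apply] at h01 h12 h13 h40 h41 h42 h43
    -- The Jordan block on `e 0`, `e 1` has no partner block at -1. This forces both `e 0` and `e 4`
    -- into the radical of ω restricted to ℝ⁵.
    have e01 : ω (e 0) (e 1) = 0 := by linarith [hneg (e 0) (e 1)]
    have e02 : ω (e 0) (e 2) = 0 := by linarith [hneg (e 1) (e 2)]
    have e03 : ω (e 0) (e 3) = 0 := by linarith [hneg (e 1) (e 3)]
    have e04 : ω (e 0) (e 4) = 0 := h40.symm
    have e40 : ω (e 4) (e 0) = 0 := by linarith [hneg (e 4) (e 0)]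
    have e41 : ω (e 4) (e 1) = 0 := by linarith [hneg (e 4) (e 1)]
    have e42 : ω (e 4) (e 2) = 0 := by linarith [hneg (e 4) (e 2)]
    have e43 : ω (e 4) (e 3) = 0 := by linarith [hneg (e 4) (e 3)]
    have w0 : ∀ x, ω (e 0) x = x.1 * ω (e 0) (1, 0) := by
      intro x
      conv_lhs => rw [hsp x]
      simp only [map_add, map_smul, smul_eq_mul, e00, e01, e02, e03, e04]
      ring
    have w4 : ∀ x, ω (e 4) x = x.1 * ω (e 4) (1, 0) := by
      intro x
      conv_lhs => rw [hsp x]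
      simp only [map_add, map_smul, smul_eq_mul, e44, e40, e41, e42, e43]
      ring
    -- That radical is at most a line: its vectors pair only with (1, 0), so this combination pairs
    -- to zero with everything.
    have hk := hnd.1 (ω (e 4) (1, 0) • e 0 - ω (e 0) (1, 0) • e 4) (by
      intro x
      simp only [map_sub, map_smul, LinearMap.sub_apply, LinearMap.smul_apply, smul_eq_mul,
        w0 x, w4 x]
      ring)
    have hk0 : ω (e 0) (1, 0) = 0 := by
      simpa [e] using congrFun (congrArg Prod.snd hk) 4
    have he0 := hnd.1 (e 0) (fun x ↦ by rw [w0, hk0, mul_zero])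
    simpa [e] using congrFun (congrArg Prod.snd he0) 0


theorem theorem6p1 :
    -- the structures pass from `g_M` to `g_{M_s}` and `g_{M_n}`
    (∀ n : ℕ, 1 ≤ n → ∀ M Ms Mn : Matrix (Fin (2 * n - 1)) (Fin (2 * n - 1)) ℝ,
      IsJordanChevalley M Ms Mn →
        (AdmitsComplexStructure (AlmostAbelian M) →
          AdmitsComplexStructure (AlmostAbelian Ms) ∧
            AdmitsComplexStructure (AlmostAbelian Mn)) ∧
        (AdmitsSymplecticStructure (AlmostAbelian M) →
          AdmitsSymplecticStructure (AlmostAbelian Ms) ∧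
            AdmitsSymplecticStructure (AlmostAbelian Mn))) ∧
    -- the converse fails for complex structures
    (∃ n : ℕ, 1 ≤ n ∧ ∃ M Ms Mn : Matrix (Fin (2 * n - 1)) (Fin (2 * n - 1)) ℝ,
      IsJordanChevalley M Ms Mn ∧
        AdmitsComplexStructure (AlmostAbelian Ms) ∧
        AdmitsComplexStructure (AlmostAbelian Mn) ∧
        ¬ AdmitsComplexStructure (AlmostAbelian M)) ∧
    -- the converse fails for symplectic structures
    (∃ n : ℕ, 1 ≤ n ∧ ∃ M Ms Mn : Matrix (Fin (2 * n - 1)) (Fin (2 * n - 1)) ℝ,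
      IsJordanChevalley M Ms Mn ∧
        AdmitsSymplecticStructure (AlmostAbelian Ms) ∧
        AdmitsSymplecticStructure (AlmostAbelian Mn) ∧
        ¬ AdmitsSymplecticStructure (AlmostAbelian M)) := by
  refine ⟨fun n _ M Ms Mn h ↦ ⟨h.admitsComplexStructure, h.admitsSymplecticStructure⟩,
    ⟨2, by norm_num, exists_complex_jordanChevalley_parts_not⟩,
    ⟨3, by norm_num, exists_symplectic_jordanChevalley_parts_not⟩⟩
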